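/- Let $R$ be a unital associative ring. For a right $R$-module $M$, let $\mathrm{Prod}(M)$ be the class of all right $R$-modules isomorphic to a direct summand of a power $M^I$, where $I$ is an arbitrary set. A submodule $M$ of a right $R$-module $N$ is pure if, for every formula $\psi(\bar x)=\exists\bar y\,(\bar xA+\bar yB=0)$ with $\bar x,\bar y$ finite tuples of variables and $A,B$ finite matrices over $R$, every tuple $\bar x$ from $M$ that satisfies $\psi$ in $N$ also satisfies it in $M$; a right $R$-module $M$ is algebraically compact (pure-injective) if it is a direct summand of every right $R$-module in which it is a pure submodule. The ring $R$ is right pure-semisimple if all right $R$-modules are algebraically compact. A cardinal $\kappa$ is measurable if it is uncountable and there is a nonprincipal $\kappa$-complete ultrafilter on $\kappa$, and a cardinal is $\omega$-measurable if it is greater than or equal to some measurable cardinal. Let $M$ be a right $R$-module such that every right $R$-module belongs to $\mathrm{Prod}(M)$ and $|M|$ is not $\omega$-measurable. Then $R$ is right pure-semisimple. -/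

import Mathlib

universe u v w

/-! Notions from the model theory of modules, for modules over an arbitrary ring `S`. A right
`R`-module is, as everywhere in Mathlib, a module over the opposite ring `Rᵐᵒᵖ`, so the notions for
right `R`-modules are obtained with `S = Rᵐᵒᵖ`. -/

namespace ModTh

/-- A positive-primitive formula in the free variables `x₀, …, xₙ₋₁`: a formula
`∃ y₀ … yₘ₋₁, ⋀ₖ (∑ᵢ aₖᵢ • xᵢ + ∑ⱼ bₖⱼ • yⱼ = 0)`, where `k` runs over finitely many equations. -/
structure PPFormula (S : Type u) (n : ℕ) where
  /-- the number of existentially quantified variables -/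
  numBound : ℕ
  /-- the number of equations -/
  numEq : ℕ
  /-- the coefficients of the free variables -/
  a : Fin numEq → Fin n → S
  /-- the coefficients of the bound variables -/
  b : Fin numEq → Fin numBound → S

/-- `ψ.Realize M x` says that `M ⊨ ψ(x)`. -/
def PPFormula.Realize {S : Type u} [Ring S] {n : ℕ} (ψ : PPFormula S n)
    (M : Type w) [AddCommGroup M] [Module S M] (x : Fin n → M) : Prop :=
  ∃ y : Fin ψ.numBound → M, ∀ k : Fin ψ.numEq,
    ∑ i, ψ.a k i • x i + ∑ j, ψ.b k j • y j = 0

/-- A submodule `P` of `N` is pure if `ψ(P) = Pⁿ ∩ ψ(N)` for every pp-formula `ψ` (in any finite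
number `n` of free variables). -/
def IsPure {S : Type u} [Ring S] {N : Type w} [AddCommGroup N] [Module S N]
    (P : Submodule S N) : Prop :=
  ∀ (n : ℕ) (ψ : PPFormula S n) (x : Fin n → P),
    ψ.Realize P x ↔ ψ.Realize N (fun i => (x i : N))

/-- `M` is algebraically compact (pure-injective) if it splits in every module in which it is
(embedded as) a pure submodule. -/
def IsAlgebraicallyCompact (S : Type u) [Ring S]
    (M : Type (max u v)) [AddCommGroup M] [Module S M] : Prop :=
  ∀ (N : Type (max u v)) [AddCommGroup N] [Module S N] (f : M →ₗ[S] N),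
    Function.Injective f → IsPure (LinearMap.range f) →
      ∃ π : N →ₗ[S] M, π ∘ₗ f = LinearMap.id

/-- `N` belongs to `Prod(M)`: it is isomorphic to a direct summand of a power `M^I` of `M`. -/
def InProd (S : Type u) [Ring S] (M : Type w) [AddCommGroup M] [Module S M]
    (N : Type w) [AddCommGroup N] [Module S N] : Prop :=
  ∃ (I : Type w) (P Q : Submodule S (I → M)), IsCompl P Q ∧ Nonempty (N ≃ₗ[S] P)

/-- The ring `R` is right pure-semisimple if all right `R`-modules are algebraically compact. -/
def IsRightPureSemisimple (R : Type u) [Ring R] : Prop :=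
  ∀ (N : Type (max u v)) [AddCommGroup N] [Module Rᵐᵒᵖ N],
    IsAlgebraicallyCompact.{u, v} Rᵐᵒᵖ N

/-- A cardinal `κ` is measurable if it is uncountable and carries a nonprincipal `κ`-complete
ultrafilter (closed under intersections of fewer than `κ` members). -/
def IsMeasurableCardinal (κ : Cardinal.{w}) : Prop :=
  Cardinal.aleph0 < κ ∧ ∃ U : Ultrafilter κ.out,
    CardinalInterFilter (U : Filter κ.out) κ ∧ ∀ a : κ.out, {a} ∉ U

/-- A cardinal is `ω`-measurable if it is greater than or equal to the first measurable cardinal,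
i.e. greater than or equal to some measurable cardinal. -/
def IsOmegaMeasurable (μ : Cardinal.{w}) : Prop :=
  ∃ κ : Cardinal.{w}, IsMeasurableCardinal κ ∧ κ ≤ μ

end ModTh

/-! A module splits wherever it is pure once decreasing chains of its solution subgroups, cut out by
growing (possibly infinite) linear systems, cannot stay strict (`exists_retraction_of_isPure`). Such
conditions are read coordinatewise in powers and pass to retracts, so it suffices to treat `M`
(`exists_solutionValues_le_succ`).

Suppose a chain on `M` is strict at every step, witnessed by elements `m n`. The sum `M^(J)` is a
retract of some `M^I`, with projection `π`. A Chase-type argument shows that the sets of coordinates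
on which `π` has negligible effect form an ideal controlled by finitely many countably complete
ultrafilters. As `|M|` is not `ω`-measurable, every map `I → M` is constant on a member of each of
them, so vectors of `M^I` are classified modulo these ultrafilters by finitely many elements of `M`.
For `J` large enough, images of `m n` placed at two different indices receive the same constants;
their difference has negligible support, yet `π` returns `m n` at one index, a contradiction. -/

namespace ModTh

/-! ### Solution subgroups of linear systems -/

section Solutions

variable {S : Type*} [Ring S] {V : Type*}

/-- The values at the unknown `x` of the solutions in `M` of the homogeneous linear system `E` in
the unknowns `V`. -/
def solutionValues (E : Set (V →₀ S)) (x : V) (M : Type*) [AddCommGroup M] [Module S M] :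
    AddSubgroup M where
  carrier := {m | ∃ g : V → M, (∀ e ∈ E, Finsupp.linearCombination S g e = 0) ∧ g x = m}
  zero_mem' := ⟨0, fun e _ => by simp, rfl⟩
  add_mem' := by
    rintro _ _ ⟨g, hg, rfl⟩ ⟨h, hh, rfl⟩
    refine ⟨g + h, fun e he => ?_, rfl⟩
    have := congrArg₂ (· + ·) (hg e he) (hh e he)
    simpa [Finsupp.linearCombination_apply, Finsupp.sum, Finset.sum_add_distrib] using this
  neg_mem' := by
    rintro _ ⟨g, hg, rfl⟩
    refine ⟨-g, fun e he => ?_, rfl⟩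
    have := hg e he
    simpa [Finsupp.linearCombination_apply, Finsupp.sum] using this

variable {M N : Type*} [AddCommGroup M] [Module S M] [AddCommGroup N] [Module S N]

theorem solutionValues_anti {E E' : Set (V →₀ S)} (h : E ⊆ E') (x : V) :
    solutionValues E' x M ≤ solutionValues E x M := by
  rintro _ ⟨g, hg, rfl⟩
  exact ⟨g, fun e he => hg e (h he), rfl⟩

theorem map_mem_solutionValues {E : Set (V →₀ S)} {x : V} (f : M →ₗ[S] N) {m : M}
    (hm : m ∈ solutionValues E x M) : f m ∈ solutionValues E x N := by
  obtain ⟨g, hg, rfl⟩ := hm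
  refine ⟨f ∘ g, fun e he => ?_, rfl⟩
  rw [← Finsupp.apply_linearCombination, hg e he, map_zero]

theorem mem_solutionValues_pi {E : Set (V →₀ S)} {x : V} {I : Type*} {a : I → M} :
    a ∈ solutionValues E x (I → M) ↔ ∀ i, a i ∈ solutionValues E x M := by
  constructor
  · intro h i
    exact map_mem_solutionValues (LinearMap.proj (R := S) (φ := fun _ : I => M) i) h
  · intro h
    choose g hg hx using h
    refine ⟨fun v i => g i v, fun e he => ?_, funext hx⟩
    funext i
    have h1 := Finsupp.apply_linearCombination S
      (LinearMap.proj (R := S) (φ := fun _ : I => M) i) (fun v i => g i v) e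
    exact h1.trans (hg i e he)

end Solutions

/-! ### Countably complete ultrafilters and measurable cardinals -/

section Ultrafilters

/-- Take the least `κ` for which `I` maps to `κ` with no fiber in `U`, and push `U` forward. If
fewer than `κ` large sets had a non-large intersection, sending each point to a set that it misses
would give such a map into a smaller cardinal. -/
theorem exists_measurable_le_of_forall_fiber_notMem {I M : Type w} (U : Ultrafilter I)
    [CountableInterFilter (U : Filter I)] (f : I → M) (hf : ∀ m, f ⁻¹' {m} ∉ U) :
    IsOmegaMeasurable (Cardinal.mk M) := by
  classical
  let P : Cardinal.{w} → Prop := fun c => ∃ g : I → c.out, ∀ m, g ⁻¹' {m} ∉ U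
  have hPtype : ∀ (T : Type w) (g : I → T), (∀ m, g ⁻¹' {m} ∉ U) → P (Cardinal.mk T) := by
    intro T g hg
    let e : T ≃ (Cardinal.mk T).out := Cardinal.outMkEquiv.symm
    refine ⟨e ∘ g, fun m => ?_⟩
    have : e ∘ g ⁻¹' {m} = g ⁻¹' {e.symm m} := by
      ext i
      simp [Equiv.eq_symm_apply]
    exact this ▸ hg (e.symm m)
  have hne : {c | P c}.Nonempty := ⟨_, hPtype M f hf⟩
  obtain ⟨g, hg⟩ : P (sInf {c | P c}) := csInf_mem hne
  have hmin : ∀ c, P c → sInf {c | P c} ≤ c := fun c hc => csInf_le' hc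
  generalize sInf {c | P c} = κ at g hg hmin
  have hκ : Cardinal.aleph0 < κ := by
    by_contra! h
    have : Countable κ.out := by
      rw [← Cardinal.mk_le_aleph0_iff, Cardinal.mk_out]; exact h
    have h1 : ⋂ m, (g ⁻¹' {m})ᶜ ∈ (U : Filter I) :=
      countable_iInter_mem.2 fun m => Ultrafilter.compl_mem_iff_notMem.2 (hg m)
    have h2 : ⋂ m, (g ⁻¹' {m})ᶜ = ∅ := by ext i; simp
    rw [h2] at h1
    exact U.empty_notMem h1
  refine ⟨κ, ⟨hκ, U.map g, ⟨fun s hs hsU => ?_⟩, hg⟩, hmin _ (hPtype M f hf)⟩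
  by_contra hcon
  let h : I → Option s := fun i => if hi : ∃ t : s, g i ∉ t.1 then some hi.choose else none
  have hnone : ∀ i, h i = none → ∀ t ∈ s, g i ∈ t := by
    intro i hi t ht
    by_contra hit
    have hex : ∃ t : s, g i ∉ t.1 := ⟨⟨t, ht⟩, hit⟩
    have : h i = some hex.choose := dif_pos hex
    simp [this] at hi
  have hsome : ∀ i t, h i = some t → g i ∉ t.1 := by
    intro i t hi
    by_cases hex : ∃ t : s, g i ∉ t.1
    · have h1 : h i = some hex.choose := dif_pos hex
      have h2 : hex.choose = t := Option.some_injective _ (h1.symm.trans hi)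
      exact h2 ▸ hex.choose_spec
    · have : h i = none := dif_neg hex
      simp [this] at hi
  have hh : P (Cardinal.mk (Option s)) := by
    refine hPtype _ h fun m hm => ?_
    cases m with
    | none => exact hcon (Filter.mem_of_superset (x := h ⁻¹' {none}) hm fun i hi => hnone i hi)
    | some t =>
      obtain ⟨i, hi, hi'⟩ := U.nonempty_of_mem (U.inter_sets hm (hsU t.1 t.2))
      exact hsome i t hi hi'
  have h1 := hmin _ hh
  rw [Cardinal.mk_option] at h1
  exact absurd h1 (not_le.2 (Cardinal.add_lt_of_lt hκ.le hs
    (Cardinal.one_lt_aleph0.trans hκ)))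

/-- A predicate on subsets of `I` defining an ideal such that every decreasing sequence of sets with
empty intersection reaches the ideal. -/
structure IsNullIdeal {I : Type*} (Null : Set I → Prop) : Prop where
  mono : ∀ {A B}, A ⊆ B → Null B → Null A
  union : ∀ {A B}, Null A → Null B → Null (A ∪ B)
  exists_of_antitone : ∀ B : ℕ → Set I, Antitone B → ⋂ m, B m = ∅ → ∃ m, Null (B m)

variable {I : Type*} {Null : Set I → Prop}

theorem IsNullIdeal.empty (h : IsNullIdeal Null) : Null ∅ := by
  obtain ⟨_, hm⟩ := h.exists_of_antitone (fun _ => ∅) (fun _ _ _ => le_rfl)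
    (Set.iInter_const ∅)
  exact hm

theorem IsNullIdeal.exists_diff_iInter (h : IsNullIdeal Null) (B : ℕ → Set I) (hB : Antitone B) :
    ∃ m, Null (B m \ ⋂ l, B l) := by
  refine h.exists_of_antitone _ (fun a b hab => Set.sdiff_subset_sdiff_left (hB hab)) ?_
  ext i
  simp only [Set.mem_iInter, Set.mem_sdiff, Set.mem_empty_iff_false, iff_false]
  intro hi
  exact (hi 0).2 fun l => (hi l).1

/-- A non-null set that cannot be split into two non-null pieces is an atom: the sets containing it
up to a null set form the ultrafilter. -/
theorem IsNullIdeal.exists_ultrafilter (h : IsNullIdeal Null) {A : Set I} (hA : ¬ Null A)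
    (hatom : ∀ X ⊆ A, Null X ∨ Null (A \ X)) :
    ∃ U : Ultrafilter I, CountableInterFilter (U : Filter I) ∧
      ∀ X, X ∈ U ↔ ¬ Null (A ∩ X) := by
  have key : ∀ X, Null (A ∩ X) ↔ ¬ Null (A \ X) := by
    intro X
    constructor
    · intro h1 h2
      exact hA (Set.inter_union_sdiff A X ▸ h.union h1 h2)
    · intro h1
      have := hatom (A ∩ X) Set.inter_subset_left
      rw [Set.sdiff_self_inter] at this
      exact this.resolve_right h1
  let F : Filter I :=
    { sets := {X | Null (A \ X)}
      univ_sets := by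
        change Null (A \ Set.univ)
        simpa using h.empty
      sets_of_superset := fun hX hXY => h.mono (Set.sdiff_subset_sdiff_right hXY) hX
      inter_sets := fun {X Y} hX hY => by
        change Null (A \ (X ∩ Y))
        rw [Set.sdiff_inter]
        exact h.union hX hY }
  have hF : ∀ X, X ∈ F ↔ Null (A \ X) := fun _ => Iff.rfl
  have hU : ∀ X, Xᶜ ∉ F ↔ X ∈ F := by
    intro X
    rw [hF, hF, Set.sdiff_compl, key, not_not]
  refine ⟨Ultrafilter.ofComplNotMemIff F hU, ?_, fun X => ?_⟩
  · refine ⟨fun s hs hsF => ?_⟩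
    change Null (A \ ⋂₀ s)
    rcases s.eq_empty_or_nonempty with rfl | hne
    · simpa using h.empty
    obtain ⟨t, rfl⟩ := hs.exists_eq_range hne
    have ht : ∀ n, Null (A \ t n) := fun n => hsF _ ⟨n, rfl⟩
    let B : ℕ → Set I := fun m => A ∩ ⋂ l ≤ m, t l
    have hB : Antitone B := fun a b hab i hi =>
      ⟨hi.1, Set.mem_iInter₂.2 fun l hl => Set.mem_iInter₂.1 hi.2 l (hl.trans hab)⟩
    have hBn : ∀ m, Null (A \ B m) := by
      intro m
      rw [Set.sdiff_self_inter]
      change (⋂ l ≤ m, t l) ∈ F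
      exact (Filter.biInter_mem (Set.finite_le_nat m)).2 fun l _ => ht l
    obtain ⟨m, hm⟩ := h.exists_diff_iInter B hB
    refine h.mono ?_ (h.union (hBn m) hm)
    rintro i ⟨hiA, hi⟩
    by_cases hiB : i ∈ B m
    · refine Or.inr ⟨hiB, fun hall => hi ?_⟩
      rintro _ ⟨n, rfl⟩
      exact Set.mem_iInter₂.1 (Set.mem_iInter.1 hall n).2 n le_rfl
    · exact Or.inl ⟨hiA, hiB⟩
  · change Null (A \ X) ↔ _
    rw [key, not_not]

/-- Otherwise `univ` is bad; a bad set is neither null nor an atom, and one of its two non-null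
pieces is bad. Repeated splitting gives a decreasing sequence with non-null successive differences,
against `exists_diff_iInter`. -/
theorem IsNullIdeal.exists_finite_ultrafilters (h : IsNullIdeal Null) :
    ∃ 𝒰 : Set (Ultrafilter I), 𝒰.Finite ∧ (∀ U ∈ 𝒰, CountableInterFilter (U : Filter I)) ∧
      ∀ X, (∀ U ∈ 𝒰, X ∉ U) → Null X := by
  let Good : Set I → Prop := fun A => ∃ 𝒰 : Set (Ultrafilter I), 𝒰.Finite ∧
    (∀ U ∈ 𝒰, CountableInterFilter (U : Filter I)) ∧ ∀ X ⊆ A, (∀ U ∈ 𝒰, X ∉ U) → Null X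
  suffices hgood : Good Set.univ by
    obtain ⟨𝒰, h1, h2, h3⟩ := hgood
    exact ⟨𝒰, h1, h2, fun X => h3 X (Set.subset_univ X)⟩
  have good_union : ∀ {A B}, Good A → Good B → Good (A ∪ B) := by
    rintro A B ⟨𝒰, h1, h2, h3⟩ ⟨𝒱, k1, k2, k3⟩
    refine ⟨𝒰 ∪ 𝒱, h1.union k1, ?_, fun X hX hXU => ?_⟩
    · rintro U (hU | hU)
      exacts [h2 U hU, k2 U hU]
    · have e : X = X ∩ A ∪ X ∩ B := by
        rw [← Set.inter_union_distrib_left, Set.inter_eq_left.2 hX]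
      rw [e]
      refine h.union (h3 _ Set.inter_subset_right fun U hU hmem => ?_)
        (k3 _ Set.inter_subset_right fun U hU hmem => ?_)
      · exact hXU U (Or.inl hU) (Filter.mem_of_superset hmem Set.inter_subset_left)
      · exact hXU U (Or.inr hU) (Filter.mem_of_superset hmem Set.inter_subset_left)
  have good_null : ∀ {A}, Null A → Good A := fun hA =>
    ⟨∅, Set.finite_empty, by simp, fun X hX _ => h.mono hX hA⟩
  have good_atom : ∀ {A}, ¬ Null A → (∀ X ⊆ A, Null X ∨ Null (A \ X)) → Good A := by
    intro A hA hatom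
    obtain ⟨U, hU, hmem⟩ := h.exists_ultrafilter hA hatom
    refine ⟨{U}, Set.finite_singleton U, by simpa using hU, fun X hX hXU => ?_⟩
    have := hXU U rfl
    rwa [hmem, not_not, Set.inter_eq_right.2 hX] at this
  have step : ∀ A : {A // ¬ Good A}, ∃ B : {B // ¬ Good B}, B.1 ⊆ A.1 ∧ ¬ Null (A.1 \ B.1) := by
    rintro ⟨A, hA⟩
    have h1 : ¬ Null A := fun hn => hA (good_null hn)
    have h2 : ∃ X ⊆ A, ¬ Null X ∧ ¬ Null (A \ X) := by
      by_contra! hcon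
      exact hA (good_atom h1 fun X hX => or_iff_not_imp_left.2 (hcon X hX))
    obtain ⟨X, hXA, hX, hX'⟩ := h2
    by_cases hg : Good X
    · have hg' : ¬ Good (A \ X) := fun hd => hA (by
        simpa [Set.union_eq_right.2 hXA] using good_union hg hd)
      exact ⟨⟨_, hg'⟩, Set.sdiff_subset, by rwa [Set.sdiff_sdiff_cancel_left hXA]⟩
    · exact ⟨⟨X, hg⟩, hXA, hX'⟩
  by_contra huniv
  choose next hsub hnn using step
  let B : ℕ → {A // ¬ Good A} := fun m => next^[m] ⟨_, huniv⟩
  have hsucc : ∀ m, B (m + 1) = next (B m) := fun m => Function.iterate_succ_apply' _ _ _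
  have hanti : Antitone fun m => (B m).1 := antitone_nat_of_succ_le fun m => by
    rw [hsucc]; exact hsub _
  obtain ⟨m, hm⟩ := h.exists_diff_iInter _ hanti
  refine hnn (B m) (h.mono (Set.sdiff_subset_sdiff_right ?_) hm)
  rw [← hsucc]
  exact Set.iInter_subset _ (m + 1)

end Ultrafilters

/-! ### Chase's argument for maps from a product to a direct sum -/

section Chase

variable {S : Type*} [Ring S] {V : Type*} {M : Type*} [AddCommGroup M] [Module S M]
  {I J : Type*}

/-- The coordinates in `A` are negligible for `π : M^I → M^(J)` if `π` maps the solution values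
supported in `A` of some member of the sequence `E` of systems to families which have, up to
finitely many coordinates, all entries among the solution values of all members of `E`. -/
def IsNegligible (π : (I → M) →ₗ[S] (J →₀ M)) (E : ℕ → Set (V →₀ S)) (x : V) (A : Set I) : Prop :=
  ∃ (n : ℕ) (F : Finset J), ∀ a ∈ solutionValues (E n) x (I → M), (∀ i ∉ A, a i = 0) →
    ∀ j ∉ F, ∀ k, π a j ∈ solutionValues (E k) x M

variable {π : (I → M) →ₗ[S] (J →₀ M)} {E : ℕ → Set (V →₀ S)} {x : V}

theorem exists_isNegligible_of_antitone (hE : Monotone E) (B : ℕ → Set I) (hB : Antitone B)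
    (hB0 : ⋂ m, B m = ∅) : ∃ m, IsNegligible π E x (B m) := by
  classical
  by_contra! hcon
  have hstep : ∀ (m : ℕ) (s : ℕ × Finset J), ∃ (a : I → M) (j : J) (k : ℕ),
      a ∈ solutionValues (E s.1) x (I → M) ∧ (∀ i ∉ B m, a i = 0) ∧ j ∉ s.2 ∧
        π a j ∉ solutionValues (E k) x M := by
    intro m s
    have := hcon m
    simp only [IsNegligible, not_exists, not_forall] at this
    obtain ⟨a, ha, ha', j, hj, k, hk⟩ := this s.1 s.2
    exact ⟨a, j, k, ha, ha', hj, hk⟩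
  choose a j k ha hsupp hj hk using hstep
  let s : ℕ → ℕ × Finset J := fun m => m.rec (0, ∅) fun m s =>
    (max s.1 (k m s), s.2 ∪ (π (a m s)).support ∪ {j m s})
  have hs : ∀ m, s (m + 1) =
    (max (s m).1 (k m (s m)), (s m).2 ∪ (π (a m (s m))).support ∪ {j m (s m)}) := fun _ => rfl
  have hs1 : Monotone fun m => (s m).1 := monotone_nat_of_le_succ fun m => by
    simp only [hs]; exact le_max_left _ _
  have hs2 : Monotone fun m => (s m).2 := monotone_nat_of_le_succ fun m => by
    simp only [hs, Finset.union_assoc]; exact Finset.subset_union_left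
  have hjmem : ∀ {l m}, l < m → j l (s l) ∈ (s m).2 := fun {l m} hlm =>
    hs2 (Nat.succ_le_of_lt hlm) (by simp [hs])
  have hsuppmem : ∀ {l m}, l < m → (π (a l (s l))).support ⊆ (s m).2 := fun {l m} hlm =>
    Finset.Subset.trans (fun t ht => by simp only [hs, Finset.mem_union]; exact Or.inl (Or.inr ht))
      (hs2 (Nat.succ_le_of_lt hlm))
  have hout : ∀ i, ∃ p, i ∉ B p := fun i => by
    have : i ∉ ⋂ m, B m := by simp [hB0]
    simpa using this
  choose p hp using hout
  have hzero : ∀ l i, p i ≤ l → a l (s l) i = 0 := fun l i hl =>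
    hsupp l (s l) i fun hi => hp i (hB hl hi)
  -- The infinite sum of the `a l (s l)` with `l ≥ m`: at coordinate `i` every term with `l ≥ p i`
  -- vanishes.
  let tail : ℕ → I → M := fun m i => ∑ l ∈ Finset.Ico m (p i), a l (s l) i
  have htail_succ : ∀ m, tail m = a m (s m) + tail (m + 1) := by
    intro m
    funext i
    simp only [tail, Pi.add_apply]
    rcases lt_or_ge m (p i) with h | h
    · exact Finset.sum_eq_sum_Ico_succ_bot h _
    · rw [hzero m i h, Finset.Ico_eq_empty (by omega), Finset.Ico_eq_empty (by omega)]
      simp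
  have htail_mem : ∀ m, tail m ∈ solutionValues (E (s m).1) x (I → M) := by
    intro m
    refine mem_solutionValues_pi.2 fun i => AddSubgroup.sum_mem _ fun l hl => ?_
    exact solutionValues_anti (hE (hs1 (Finset.mem_Ico.1 hl).1)) x
      (mem_solutionValues_pi.1 (ha l (s l)) i)
  have htail_zero : ∀ m, tail 0 = ∑ l ∈ Finset.range m, a l (s l) + tail m := by
    intro m
    induction m with
    | zero => simp
    | succ m ih => rw [ih, htail_succ m, Finset.sum_range_succ, add_assoc]
  -- At `j m (s m)` earlier terms contribute zero, as this index avoids their supports, and later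
  -- ones lie in the subgroup that the `m`-th term avoids. So `π (tail 0)` would have infinite
  -- support.
  have hne : ∀ m, π (tail 0) (j m (s m)) ≠ 0 := by
    intro m h0
    have h1 : ∑ l ∈ Finset.range m, π (a l (s l)) (j m (s m)) = 0 :=
      Finset.sum_eq_zero fun l hl => by
        by_contra h
        exact hj m (s m) (hsuppmem (Finset.mem_range.1 hl) (Finsupp.mem_support_iff.2 h))
    have h2 : π (tail (m + 1)) (j m (s m)) ∈ solutionValues (E (k m (s m))) x M := by
      refine solutionValues_anti (hE (?_ : k m (s m) ≤ (s (m + 1)).1)) x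
        (map_mem_solutionValues ((Finsupp.lapply (j m (s m))).comp π) (htail_mem (m + 1)))
      simp [hs]
    rw [htail_zero m, htail_succ m, map_add, map_add, map_sum, Finsupp.add_apply,
      Finsupp.finsetSum_apply, h1, zero_add, Finsupp.add_apply] at h0
    exact hk m (s m) (eq_neg_of_add_eq_zero_left h0 ▸ neg_mem h2)
  have hinj : Function.Injective fun m => j m (s m) :=
    .of_lt_imp_ne fun l m hlm heq => hj m (s m) (heq ▸ hjmem hlm)
  exact Set.infinite_range_of_injective hinj
    ((π (tail 0)).support.finite_toSet.subset (by
      rintro _ ⟨m, rfl⟩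
      exact Finsupp.mem_support_iff.2 (hne m)))

theorem isNullIdeal_isNegligible (hE : Monotone E) : IsNullIdeal (IsNegligible π E x) where
  mono := by
    rintro A B hAB ⟨n, F, h⟩
    exact ⟨n, F, fun a ha ha0 => h a ha fun i hi => ha0 i fun hiA => hi (hAB hiA)⟩
  union := by
    classical
    rintro A B ⟨n, F, h⟩ ⟨n', F', h'⟩
    refine ⟨max n n', F ∪ F', fun a ha ha0 j hj k => ?_⟩
    rw [Finset.mem_union, not_or] at hj
    rw [mem_solutionValues_pi] at ha
    have hsplit : a = A.indicator a + Aᶜ.indicator a := (Set.indicator_self_add_compl A a).symm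
    have hmem : ∀ (C : Set I) (l : ℕ), l ≤ max n n' →
        C.indicator a ∈ solutionValues (E l) x (I → M) := by
      refine fun C l hl => mem_solutionValues_pi.2 fun i => ?_
      by_cases hi : i ∈ C
      · rw [Set.indicator_of_mem hi]
        exact solutionValues_anti (hE hl) x (ha i)
      · rw [Set.indicator_of_notMem hi]
        exact zero_mem _
    rw [hsplit, map_add, Finsupp.add_apply]
    refine add_mem (h _ (hmem A n (le_max_left _ _)) (fun i hi => Set.indicator_of_notMem hi _)
      j hj.1 k) (h' _ (hmem Aᶜ n' (le_max_right _ _)) (fun i hi => ?_) j hj.2 k)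
    by_cases hiA : i ∈ A
    · exact Set.indicator_of_notMem (by simpa using hiA) _
    · rw [Set.indicator_of_mem hiA]
      exact ha0 i (by simp [hiA, hi])
  exists_of_antitone := exists_isNegligible_of_antitone hE

end Chase

/-! ### The chain condition for `M` and for modules in `Prod(M)` -/

section Stationary

variable {S : Type u} [Ring S]

theorem InProd.exists_retraction {M N : Type w} [AddCommGroup M] [Module S M] [AddCommGroup N]
    [Module S N] (h : InProd S M N) :
    ∃ (I : Type w) (ι : N →ₗ[S] (I → M)) (π : (I → M) →ₗ[S] N), ∀ y, π (ι y) = y := by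
  obtain ⟨I, P, Q, hPQ, ⟨e⟩⟩ := h
  refine ⟨I, P.subtype ∘ₗ e.toLinearMap, e.symm.toLinearMap ∘ₗ P.projectionOnto Q hPQ, fun y => ?_⟩
  simp

/-- If `M` is not of `ω`-measurable cardinality and the direct sums `M^(J)` belong to `Prod(M)`,
then `M` satisfies the descending chain condition on subgroups of solution values. -/
theorem exists_solutionValues_le_succ {M : Type w} [AddCommGroup M] [Module S M]
    (hProd : ∀ J : Type w, InProd S M (J →₀ M)) (hM : ¬ IsOmegaMeasurable (Cardinal.mk M))
    {V : Type*} (E : ℕ → Set (V →₀ S)) (hE : Monotone E) (x : V) :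
    ∃ n, solutionValues (E n) x M ≤ solutionValues (E (n + 1)) x M := by
  classical
  by_contra! hcon
  have hcon' : ∀ n, ∃ m ∈ solutionValues (E n) x M, m ∉ solutionValues (E (n + 1)) x M :=
    fun n => SetLike.not_le_iff_exists.1 (hcon n)
  choose m hm hm' using hcon'
  -- A power set, so that Cantor's theorem defeats the coding by constants below. The factor `ℕ` in
  -- `K × ℕ` leaves room to avoid a finite set of indices with the first component fixed.
  let K := Set (ℕ → ℕ → ℕ → M)
  obtain ⟨I, ι, π, hπ⟩ := (hProd (K × ℕ)).exists_retraction
  obtain ⟨𝒰, hfin, hcount, hnull⟩ :=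
    (isNullIdeal_isNegligible (π := π) (x := x) hE).exists_finite_ultrafilters
  let a : ℕ → K × ℕ → I → M := fun n j => ι (Finsupp.single j (m n))
  have hconst : ∀ (U : 𝒰) (b : I → M), ∃ c, b ⁻¹' {c} ∈ U.1 := by
    intro U b
    by_contra! hb
    have := hcount U.1 U.2
    exact hM (exists_measurable_le_of_forall_fiber_notMem U.1 b hb)
  choose c hc using hconst
  have : Countable 𝒰 := hfin.countable.to_subtype
  obtain ⟨e, he⟩ := Countable.exists_injective_nat 𝒰
  let code : K → (ℕ → ℕ → ℕ → M) := fun t l n =>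
    Function.extend e (fun U => c U (a n (t, l))) 0
  obtain ⟨t, t', htt, hne⟩ : ∃ t t', code t = code t' ∧ t ≠ t' := by
    simpa [Function.Injective] using Function.cantor_injective code
  have hcc : ∀ U l n, c U (a n (t, l)) = c U (a n (t', l)) := by
    intro U l n
    have := congrFun (congrFun (congrFun htt l) n) (e U)
    simpa only [code, he.extend_apply] using this
  -- The union runs over all `l` and `n` because the level and the finite exceptional set are known
  -- only after `Y` is shown negligible.
  let Y : Set I := ⋃ l, ⋃ n, {i | a n (t, l) i ≠ a n (t', l) i}
  have hY : IsNegligible π E x Y := by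
    refine hnull Y fun U hU hYU => ?_
    have := hcount U hU
    have h1 : ⋂ l, ⋂ n, {i | a n (t, l) i = a n (t', l) i} ∈ (U : Filter I) := by
      refine countable_iInter_mem.2 fun l => countable_iInter_mem.2 fun n => ?_
      filter_upwards [hc ⟨U, hU⟩ (a n (t, l)), hc ⟨U, hU⟩ (a n (t', l))] with i hi hi'
      exact Eq.trans hi ((hcc _ l n).trans (Eq.symm hi'))
    obtain ⟨i, hi, hi'⟩ := U.nonempty_of_mem (U.inter_sets hYU h1)
    simp only [Y, Set.mem_iUnion, Set.mem_iInter, Set.mem_ofPred_eq] at hi hi'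
    obtain ⟨l, n, hln⟩ := hi
    exact hln (hi' l n)
  obtain ⟨n, F, hF⟩ := hY
  obtain ⟨l, hl⟩ : ∃ l, (t, l) ∉ F := by
    by_contra! hall
    exact Set.infinite_range_of_injective (f := fun l : ℕ => (t, l))
      (fun _ _ h => (Prod.ext_iff.1 h).2)
      (F.finite_toSet.subset (by rintro _ ⟨l, rfl⟩; exact hall l))
  have hamem : ∀ j, a n j ∈ solutionValues (E n) x (I → M) := fun j =>
    map_mem_solutionValues (ι ∘ₗ Finsupp.lsingle j) (hm n)
  have h1 := hF (a n (t, l) - a n (t', l)) (sub_mem (hamem _) (hamem _)) (fun i hi => by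
    simp only [Y, Set.mem_iUnion, Set.mem_ofPred_eq, not_exists, not_not] at hi
    exact sub_eq_zero.2 (hi l n)) (t, l) hl (n + 1)
  have h2 : (t', l) ≠ (t, l) := fun h => hne (Prod.ext_iff.1 h).1.symm
  rw [map_sub, Finsupp.sub_apply, hπ, hπ, Finsupp.single_eq_same,
    Finsupp.single_eq_of_ne h2.symm, sub_zero] at h1
  exact hm' n h1

theorem InProd.solutionValues_le {M N : Type w} [AddCommGroup M] [Module S M] [AddCommGroup N]
    [Module S N] (h : InProd S M N) {V : Type*} {E E' : Set (V →₀ S)} {x : V}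
    (hle : solutionValues E x M ≤ solutionValues E' x M) :
    solutionValues E x N ≤ solutionValues E' x N := by
  obtain ⟨I, ι, π, hπ⟩ := h.exists_retraction
  intro y hy
  rw [← hπ y]
  refine map_mem_solutionValues π (mem_solutionValues_pi.2 fun i => hle ?_)
  exact mem_solutionValues_pi.1 (map_mem_solutionValues ι hy) i

end Stationary

/-! ### Splitting pure embeddings by extending partial solutions -/

section Retraction

variable {S : Type*} [Ring S] {N N' : Type w} [AddCommGroup N] [Module S N]
  [AddCommGroup N'] [Module S N']

/-- The finite set `E` consists of linear relations between elements of `N'`. -/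
def IsRelationSet (E : Finset (N' →₀ S)) : Prop :=
  ∀ e ∈ E, Finsupp.linearCombination S (id : N' → N') e = 0

/-- Every finite set of linear relations between elements of `N'` is satisfied by some function
`N' → N` whose graph contains `G`. -/
def IsFinitelySolvable (S : Type*) [Ring S] {N N' : Type*} [AddCommGroup N] [Module S N]
    [AddCommGroup N'] [Module S N'] (G : Set (N' × N)) : Prop :=
  ∀ E : Finset (N' →₀ S), IsRelationSet E → ∃ g : N' → N, (∀ p ∈ G, g p.1 = p.2) ∧
    ∀ e ∈ E, Finsupp.linearCombination S g e = 0

theorem IsFinitelySolvable.snd_eq {G : Set (N' × N)} (hG : IsFinitelySolvable S G) {p q : N' × N}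
    (hp : p ∈ G) (hq : q ∈ G) (h : p.1 = q.1) : p.2 = q.2 := by
  obtain ⟨g, hg, -⟩ := hG ∅ (by simp [IsRelationSet])
  rw [← hg p hp, ← hg q hq, h]

theorem linearCombination_congr {V : Type*} {g h : V → N} {e : V →₀ S}
    (hgh : ∀ v ∈ e.support, g v = h v) :
    Finsupp.linearCombination S g e = Finsupp.linearCombination S h e := by
  simp only [Finsupp.linearCombination_apply]
  exact Finsupp.sum_congr fun v hv => by rw [hgh v hv]

/-- A finite set of relations involves finitely many elements, so one member of the chain already
prescribes all the relevant values. -/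
theorem isFinitelySolvable_sUnion {C : Set (Set (N' × N))} (hC : IsChain (· ⊆ ·) C)
    (hne : C.Nonempty) (hG : ∀ G ∈ C, IsFinitelySolvable S G) : IsFinitelySolvable S (⋃₀ C) := by
  classical
  intro E hE
  have hdir : DirectedOn (· ⊆ ·) C := hC.directedOn
  have hfun : ∀ p ∈ ⋃₀ C, ∀ q ∈ ⋃₀ C, p.1 = q.1 → p.2 = q.2 := by
    rintro p ⟨G, hGC, hp⟩ q ⟨H, hHC, hq⟩ hpq
    obtain ⟨L, hL, hGL, hHL⟩ := hdir G hGC H hHC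
    exact (hG L hL).snd_eq (hGL hp) (hHL hq) hpq
  let T : Finset N' := E.biUnion Finsupp.support
  let W : Set (N' × N) := {p | p ∈ ⋃₀ C ∧ p.1 ∈ T}
  have hW : W.Finite := by
    refine Set.Finite.of_finite_image (f := Prod.fst) (T.finite_toSet.subset ?_) ?_
    · rintro _ ⟨p, hp, rfl⟩
      exact hp.2
    · exact fun p hp q hq h => Prod.ext h (hfun p hp.1 q hq.1 h)
  obtain ⟨G, hGC, hWG⟩ := hdir.exists_mem_subset_of_finite_of_subset_sUnion hne hW fun p hp => hp.1
  obtain ⟨g, hg, hgE⟩ := hG G hGC E hE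
  let g' : N' → N := fun v => if h : ∃ y, (v, y) ∈ ⋃₀ C then h.choose else g v
  have hg' : ∀ p ∈ ⋃₀ C, g' p.1 = p.2 := by
    intro p hp
    have h : ∃ y, (p.1, y) ∈ ⋃₀ C := ⟨p.2, hp⟩
    have h1 : g' p.1 = h.choose := dif_pos h
    rw [h1]
    exact hfun (p.1, h.choose) h.choose_spec p hp rfl
  refine ⟨g', hg', fun e he => ?_⟩
  rw [← hgE e he]
  refine linearCombination_congr fun v hv => ?_
  by_cases h : ∃ y, (v, y) ∈ ⋃₀ C
  · obtain ⟨y, hy⟩ := h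
    exact (hg' _ hy).trans
      (hg (v, y) (hWG ⟨hy, Finset.mem_biUnion.2 ⟨e, he, hv⟩⟩)).symm
  · exact dif_neg h

/-- The chain condition gives a finite `E` whose subgroup no further relations shrink. The value at
`x` of any solution `g` of `E` works: a solution `g'` of `E ∪ E'` differs from it at `x` by an
element of that subgroup, hence can be corrected by a homogeneous solution of `E ∪ E'`. -/
theorem IsFinitelySolvable.exists_insert {G : Set (N' × N)} (hG : IsFinitelySolvable S G) (x : N')
    (hdcc : ∀ E : ℕ → Set (N' →₀ S), Monotone E →
      ∃ n, solutionValues (E n) x N ≤ solutionValues (E (n + 1)) x N) :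
    ∃ y, IsFinitelySolvable S (insert (x, y) G) := by
  classical
  -- These equations force corrections to vanish where `G` already prescribes values.
  let Z : Set (N' →₀ S) := (fun p : N' × N => Finsupp.single p.1 1) '' G
  let H : Finset (N' →₀ S) → AddSubgroup N := fun E => solutionValues (↑E ∪ Z) x N
  obtain ⟨E, hE, hmin⟩ : ∃ E : Finset (N' →₀ S), IsRelationSet E ∧
      ∀ E', IsRelationSet E' → E ⊆ E' → H E ≤ H E' := by
    by_contra! hcon
    have hstep : ∀ E : {E : Finset (N' →₀ S) // IsRelationSet E},
        ∃ E' : {E : Finset (N' →₀ S) // IsRelationSet E}, E.1 ⊆ E'.1 ∧ ¬ H E.1 ≤ H E'.1 := by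
      rintro ⟨E, hE⟩
      obtain ⟨E', h1, h2, h3⟩ := hcon E hE
      exact ⟨⟨E', h1⟩, h2, h3⟩
    choose next hsub hnle using hstep
    let E : ℕ → {E : Finset (N' →₀ S) // IsRelationSet E} := fun n =>
      next^[n] ⟨∅, by simp [IsRelationSet]⟩
    have hsucc : ∀ n, E (n + 1) = next (E n) := fun n => Function.iterate_succ_apply' _ _ _
    obtain ⟨n, hn⟩ := hdcc (fun n => ↑(E n).1 ∪ Z) (monotone_nat_of_le_succ fun n => by
      rw [hsucc]
      exact Set.union_subset_union_left _ (Finset.coe_subset.2 (hsub _)))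
    rw [hsucc] at hn
    exact hnle _ hn
  obtain ⟨g, hg, hgE⟩ := hG E hE
  refine ⟨g x, fun E' hE' => ?_⟩
  have hEE' : IsRelationSet (E ∪ E') := fun e he =>
    (Finset.mem_union.1 he).elim (hE e) (hE' e)
  obtain ⟨g', hg', hgE'⟩ := hG _ hEE'
  have hsub : ∀ (e : N' →₀ S) (k l : N' → N), Finsupp.linearCombination S (k - l) e =
      Finsupp.linearCombination S k e - Finsupp.linearCombination S l e := by
    intro e k l
    simp [Finsupp.linearCombination_apply, Finsupp.sum, smul_sub]
  have hmem : g x - g' x ∈ H E := by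
    refine ⟨g - g', ?_, rfl⟩
    rintro e (he | ⟨p, hp, rfl⟩)
    · rw [hsub, hgE e he, hgE' e (Finset.mem_union_left _ he), sub_zero]
    · rw [hsub]
      simp [hg p hp, hg' p hp]
  obtain ⟨h, hh, hhx⟩ := hmin _ hEE' Finset.subset_union_left hmem
  have hadd : ∀ e : N' →₀ S, Finsupp.linearCombination S (g' + h) e =
      Finsupp.linearCombination S g' e + Finsupp.linearCombination S h e := by
    intro e
    simp [Finsupp.linearCombination_apply, Finsupp.sum, Finset.sum_add_distrib]
  refine ⟨g' + h, ?_, fun e he => ?_⟩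
  · rintro p (rfl | hp)
    · simp [hhx]
    · have := hh _ (Or.inr ⟨p, hp, rfl⟩)
      simp only [Finsupp.linearCombination_single, one_smul] at this
      simp [hg' p hp, this]
  · have he' := Finset.mem_union_right E he
    rw [hadd, hgE' e he', hh e (Or.inl he'), add_zero]

theorem sum_equivFin {X : Type*} [AddCommMonoid X] {V : Type*} (T : Finset V) (φ : V → X) :
    ∑ i, φ (T.equivFin.symm i) = ∑ v ∈ T, φ v := by
  rw [Equiv.sum_comp T.equivFin.symm (fun v : T => φ v), Finset.sum_coe_sort]

/-- The elements of `range f` occurring in `E` become free variables and the others bound ones;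
purity moves the bound ones into `range f`. -/
theorem isFinitelySolvable_range_of_isPure {f : N →ₗ[S] N'} (hf : Function.Injective f)
    (hpure : IsPure (LinearMap.range f)) :
    IsFinitelySolvable S (Set.range fun y : N => (f y, y)) := by
  classical
  intro E hE
  let T : Finset N' := E.biUnion Finsupp.support
  let T₁ := T.filter (· ∈ LinearMap.range f)
  let T₂ := T.filter (· ∉ LinearMap.range f)
  let ψ : PPFormula S T₁.card :=
    { numBound := T₂.card
      numEq := E.card
      a := fun k i => (E.equivFin.symm k).1 (T₁.equivFin.symm i).1
      b := fun k i => (E.equivFin.symm k).1 (T₂.equivFin.symm i).1 }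
  have hsum : ∀ (h : N' → N') (k : Fin E.card),
      ∑ i, ψ.a k i • h (T₁.equivFin.symm i) + ∑ i, ψ.b k i • h (T₂.equivFin.symm i) =
        Finsupp.linearCombination S h (E.equivFin.symm k).1 := by
    intro h k
    have hk : (E.equivFin.symm k).1.support ⊆ T :=
      Finset.subset_biUnion_of_mem Finsupp.support (E.equivFin.symm k).2
    rw [Finsupp.linearCombination_apply, Finsupp.sum_of_support_subset _ hk _ (by simp),
      ← Finset.sum_filter_add_sum_filter_not T (· ∈ LinearMap.range f)]
    exact congrArg₂ _ (sum_equivFin T₁ fun v => (E.equivFin.symm k).1 v • h v)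
      (sum_equivFin T₂ fun v => (E.equivFin.symm k).1 v • h v)
  let x : Fin T₁.card → LinearMap.range f := fun i =>
    ⟨(T₁.equivFin.symm i).1, (Finset.mem_filter.1 (T₁.equivFin.symm i).2).2⟩
  have hreal : ψ.Realize N' fun i => (x i : N') :=
    ⟨fun i => (T₂.equivFin.symm i).1, fun k =>
      (hsum id k).trans (hE _ (E.equivFin.symm k).2)⟩
  obtain ⟨y, hy⟩ := (hpure _ ψ x).2 hreal
  let h : N' → N' := fun v => if hv : v ∈ T₂ then y (T₂.equivFin ⟨v, hv⟩) else v
  have hT₂ : ∀ v ∈ LinearMap.range f, v ∉ T₂ := fun v hv hv' => (Finset.mem_filter.1 hv').2 hv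
  have hh₁ : ∀ v ∈ LinearMap.range f, h v = v := fun v hv => dif_neg (hT₂ v hv)
  have hh₂ : ∀ i, h (T₂.equivFin.symm i) = y i := fun i => by
    simp only [h]
    rw [dif_pos (T₂.equivFin.symm i).2]
    simp
  let g : N' → N := Function.invFun f ∘ h
  have hfg : ∀ v ∈ T, f (g v) = h v := by
    intro v hv
    refine Function.invFun_eq (?_ : h v ∈ LinearMap.range f)
    by_cases hvf : v ∈ LinearMap.range f
    · rwa [hh₁ v hvf]
    · have hv₂ : v ∈ T₂ := Finset.mem_filter.2 ⟨hv, hvf⟩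
      simp only [h, dif_pos hv₂]
      exact (y _).2
  refine ⟨g, ?_, fun e he => hf ?_⟩
  · rintro _ ⟨z, rfl⟩
    change Function.invFun f (h (f z)) = z
    rw [hh₁ _ ⟨z, rfl⟩]
    exact Function.leftInverse_invFun hf z
  · rw [Finsupp.apply_linearCombination, map_zero,
      linearCombination_congr (g := f ∘ g) (h := h) fun v hv => hfg v (Finset.mem_biUnion.2 ⟨e, he, hv⟩)]
    have hk := hsum h (E.equivFin ⟨e, he⟩)
    rw [Equiv.symm_apply_apply] at hk
    rw [← hk]
    have := congrArg (Subtype.val) (hy (E.equivFin ⟨e, he⟩))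
    simp only [Submodule.coe_add, AddSubmonoidClass.coe_finsetSum, Submodule.coe_smul,
      Submodule.coe_zero] at this
    rw [← this]
    refine congrArg₂ _ (Finset.sum_congr rfl fun i _ => ?_) (Finset.sum_congr rfl fun i _ => ?_)
    · rw [hh₁ _ (x i).2]
    · rw [hh₂]

/-- A module satisfying the descending chain condition on subgroups of solution values splits in
every module in which it is pure. -/
theorem exists_retraction_of_isPure {f : N →ₗ[S] N'} (hf : Function.Injective f)
    (hpure : IsPure (LinearMap.range f))
    (hdcc : ∀ (x : N') (E : ℕ → Set (N' →₀ S)), Monotone E →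
      ∃ n, solutionValues (E n) x N ≤ solutionValues (E (n + 1)) x N) :
    ∃ π : N' →ₗ[S] N, π ∘ₗ f = LinearMap.id := by
  classical
  obtain ⟨G, hG0, hG⟩ := zorn_subset_nonempty {G : Set (N' × N) | IsFinitelySolvable S G}
    (fun C hC hchain hne => ⟨⋃₀ C, isFinitelySolvable_sUnion hchain hne hC,
      fun _ => Set.subset_sUnion_of_mem⟩) _ (isFinitelySolvable_range_of_isPure hf hpure)
  have hsolv : IsFinitelySolvable S G := hG.prop
  have htot : ∀ x, ∃ y, (x, y) ∈ G := by
    intro x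
    obtain ⟨y, hy⟩ := hsolv.exists_insert x (hdcc x)
    exact ⟨y, hG.le_of_ge hy (Set.subset_insert _ _) (Set.mem_insert _ _)⟩
  choose φ hφ using htot
  -- Additivity and homogeneity are themselves linear relations in `N'`, so preserving relations
  -- makes `φ` linear.
  have hrel : ∀ e : N' →₀ S, Finsupp.linearCombination S (id : N' → N') e = 0 →
      Finsupp.linearCombination S φ e = 0 := by
    intro e he
    obtain ⟨g, hg, hge⟩ := hsolv {e} (by simpa [IsRelationSet] using he)
    have : g = φ := funext fun x => hg _ (hφ x)
    exact this ▸ hge e (Finset.mem_singleton_self e)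
  refine ⟨{ toFun := φ, map_add' := fun x y => ?_, map_smul' := fun r x => ?_ },
    LinearMap.ext fun y => hsolv.snd_eq (hφ (f y)) (hG0 ⟨y, rfl⟩) rfl⟩
  · have := hrel (Finsupp.single (x + y) 1 - (Finsupp.single x 1 + Finsupp.single y 1)) (by simp)
    simpa [sub_eq_zero] using this
  · have := hrel (Finsupp.single (r • x) 1 - Finsupp.single x r) (by simp)
    simpa [sub_eq_zero] using this

end Retraction

end ModTh

theorem corollary4p4 (R : Type u) [Ring R]
    (M : Type (max u v)) [AddCommGroup M] [Module Rᵐᵒᵖ M]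
    (hProd : ∀ (N : Type (max u v)) [AddCommGroup N] [Module Rᵐᵒᵖ N],
      ModTh.InProd Rᵐᵒᵖ M N)
    (hM : ¬ ModTh.IsOmegaMeasurable (Cardinal.mk M)) :
    ModTh.IsRightPureSemisimple.{u, v} R := by
  intro N _ _ N' _ _ f hf hpure
  refine ModTh.exists_retraction_of_isPure hf hpure fun x E hE => ?_
  obtain ⟨n, hn⟩ := ModTh.exists_solutionValues_le_succ (fun J => hProd (J →₀ M)) hM E hE x
  exact ⟨n, (hProd N).solutionValues_le hn⟩
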